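/- Let $R$ be an associative ring with identity. All modules are left $R$-modules. Definitions. For an integer $n\ge 1$, a module $M$ is called *$n$-SG-projective* ($n$-strongly Gorenstein projective) if there is an exact sequence $$0\to M\xrightarrow{f_n}P_{n-1}\xrightarrow{f_{n-1}}\cdots\xrightarrow{f_1}P_0\xrightarrow{f_0}M\to 0 \qquad(\ast)$$ with every $P_i$ projective, such that $\operatorname{Hom}_R(-,Q)$ leaves the sequence exact for every projective module $Q$. A module $G$ is called *Gorenstein projective* if there is an exact sequence $\cdots\to P_1\to P_0\to P^0\to P^1\to\cdots$ of projective modules such that $\operatorname{Hom}_R(-,Q)$ leaves the sequence exact for every projective module $Q$ and $G\cong\operatorname{Im}(P_0\to P^0)$. Theorem 3.9. For every module $M$ and every integer $n\ge 1$, the following five statements are equivalent. 1. $M$ is $n$-SG-projective. 2. There is an exact sequence of the form $(\ast)$ with $P_i$ projective for all $0\le i\le n-1$ such that $\bigoplus_{i=1}^n\operatorname{Im}f_i$ is $1$-SG-projective. 3. There is an exact sequence of the form $(\ast)$ with $P_i$ projective for all $0\le i\le n-1$ such that $\bigoplus_{i=1}^n\operatorname{Im}f_i$ is Gorenstein projective.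 4. There is an exact sequence of the form $(\ast)$ with $P_i$ of finite projective dimension for all $0\le i\le n-1$ such that $\bigoplus_{i=1}^n\operatorname{Im}f_i$ is $1$-SG-projective. 5. There is an exact sequence of the form $(\ast)$ with $P_i$ of finite projective dimension for all $0\le i\le n-1$ such that $\bigoplus_{i=1}^n\operatorname{Im}f_i$ is Gorenstein projective. -/

import Mathlib

open CategoryTheory
open scoped DirectSum

universe u v

/-- An exact sequence of left `R`-modules
`0 → M --f n--> P_{n-1} --f (n-1)--> ⋯ --f 1--> P_0 --f 0--> M → 0`.

The nonzero terms are `X 0, X 1, …, X (n + 1)`: the two ends `X 0` and `X (n + 1)` are identified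
with `M`, and `X (i + 1)` is the middle term `P_i` for `i < n`. The map `f i : X (i + 1) → X i` is
the map written `f_i : P_i → P_{i-1}`, where `P_n = M = P_{-1}`.
The modules `X i` with `i > n + 1` and the maps `f i` with `i > n` are not part of the sequence:
nothing is required of them and nothing below refers to them. -/
structure SelfExactSeq (R : Type u) [Ring R] (M : Type v) [AddCommGroup M] [Module R M]
    (n : ℕ) where
  X : ℕ → ModuleCat.{v} R
  f : (i : ℕ) → X (i + 1) →ₗ[R] X i
  rightEnd : X 0 ≃ₗ[R] M
  leftEnd : X (n + 1) ≃ₗ[R] M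
  surjective_f : Function.Surjective (f 0)
  exact_f : ∀ i < n, Function.Exact (f (i + 1)) (f i)
  injective_f : Function.Injective (f n)

namespace SelfExactSeq

variable {R : Type u} [Ring R] {M : Type v} [AddCommGroup M] [Module R M] {n : ℕ}

/-- The middle term `P_i` (for `i < n`). -/
abbrev P (S : SelfExactSeq R M n) (i : ℕ) : ModuleCat.{v} R := S.X (i + 1)

/-- The direct sum `⨁_{i = 1}^{n} Im f_i`. -/
abbrev SumIm (S : SelfExactSeq R M n) : Type v :=
  ⨁ i : Fin n, LinearMap.range (S.f ((i : ℕ) + 1))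

/-- `Hom_R(-, Q)` leaves the sequence exact: the sequence of abelian groups
`0 → Hom(M, Q) → Hom(P_0, Q) → ⋯ → Hom(P_{n-1}, Q) → Hom(M, Q) → 0` is exact. -/
structure HomExact (S : SelfExactSeq R M n) (Q : Type v) [AddCommGroup Q] [Module R Q] :
    Prop where
  injective : Function.Injective (fun φ : S.X 0 →ₗ[R] Q => φ ∘ₗ S.f 0)
  exact : ∀ i < n, Function.Exact (fun φ : S.X i →ₗ[R] Q => φ ∘ₗ S.f i)
    (fun φ : S.X (i + 1) →ₗ[R] Q => φ ∘ₗ S.f (i + 1))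
  surjective : Function.Surjective (fun φ : S.X n →ₗ[R] Q => φ ∘ₗ S.f n)

end SelfExactSeq

/-- `M` is `n`-strongly Gorenstein projective (meant for `n ≥ 1`). -/
def IsNSGProjective (R : Type u) [Ring R] (n : ℕ) (M : Type v) [AddCommGroup M] [Module R M] :
    Prop :=
  ∃ S : SelfExactSeq R M n,
    (∀ i < n, Module.Projective R (S.P i)) ∧
    ∀ (Q : Type v) [AddCommGroup Q] [Module R Q], Module.Projective R Q → S.HomExact Q

/-- `G` is Gorenstein projective: it is the image of the map `X 1 → X 0` of an exact sequence
`⋯ → X 2 → X 1 → X 0 → X (-1) → ⋯` of projective modules that stays exact under `Hom_R(-, Q)`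
for every projective module `Q`. -/
def IsGorensteinProjective (R : Type u) [Ring R] (G : Type v) [AddCommGroup G] [Module R G] :
    Prop :=
  ∃ (X : ℤ → ModuleCat.{v} R) (d : (i : ℤ) → X (i + 1) →ₗ[R] X i),
    (∀ i, Function.Exact (d (i + 1)) (d i)) ∧
    (∀ i, Module.Projective R (X i)) ∧
    (∀ (Q : Type v) [AddCommGroup Q] [Module R Q], Module.Projective R Q →
      ∀ i, Function.Exact (fun φ : X i →ₗ[R] Q => φ ∘ₗ d i)
        (fun φ : X (i + 1) →ₗ[R] Q => φ ∘ₗ d (i + 1))) ∧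
    Nonempty (G ≃ₗ[R] LinearMap.range (d 0))

/-- `M` has finite projective dimension (the zero module included). -/
def HasFiniteProjDim (R : Type u) [Ring R] (M : Type v) [AddCommGroup M] [Module R M] : Prop :=
  projectiveDimension (ModuleCat.of R M) ≠ ⊤

/-! Cut the sequence into the short exact sequences `0 → Im f_{i+1} → P_i → Im f_i → 0` for `i < n`
and add them up. Since `Im f_0 ≅ M ≅ Im f_n`, the two outer sums agree up to a rotation of the
indices, so with `D = ⨁ Im f_i` there is one sequence `0 → D → ⨁ P_i → D → 0`, still exact under
`Hom(-, Q)` (`isNSGProjective_one_sumIm`). Splicing copies of such a sequence gives a complete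
resolution of `D`.

Conversely, if `D` is Gorenstein projective then `Ext¹(D, Q) = 0` for all `Q` of finite projective
dimension, by dimension shifting. Each `Im f_i` is isomorphic to a summand of `D`, so it inherits
the vanishing, and so does each `P_i`, being an extension of two of them. A `P_i` of finite
projective dimension is then projective, and the vanishing for projective `Q` is Hom-exactness. -/

open Function

/-! ### Elementary vanishing of `Ext¹` -/

section Extension

variable {R : Type u} [Ring R]

/-- `Ext¹(K, Q) = 0`, phrased elementarily: every map into `Q` from the kernel of a surjection
onto `K` extends to the whole source. -/
def ExtOneVanishes (R : Type u) [Ring R] (K Q : Type v) [AddCommGroup K] [Module R K]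
    [AddCommGroup Q] [Module R Q] : Prop :=
  ∀ (B : Type v) [AddCommGroup B] [Module R B] (p : B →ₗ[R] K), Surjective p →
    ∀ φ : LinearMap.ker p →ₗ[R] Q, ∃ ψ : B →ₗ[R] Q, ∀ x : LinearMap.ker p, ψ x = φ x

theorem LinearMap.exists_comp_eq_of_surjective {A B C : Type*} [AddCommGroup A] [Module R A]
    [AddCommGroup B] [Module R B] [AddCommGroup C] [Module R C] {p : A →ₗ[R] B}
    (hp : Surjective p) (φ : A →ₗ[R] C) (h : ∀ x, p x = 0 → φ x = 0) :
    ∃ χ : B →ₗ[R] C, ∀ x, χ (p x) = φ x := by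
  refine ⟨(LinearMap.ker p).liftQ φ (fun x hx => h x hx) ∘ₗ
    (p.quotKerEquivOfSurjective hp).symm.toLinearMap, fun x => ?_⟩
  have : (p.quotKerEquivOfSurjective hp).symm (p x) = Submodule.Quotient.mk x := by
    rw [LinearEquiv.symm_apply_eq]; rfl
  rw [LinearMap.comp_apply, LinearEquiv.coe_coe, this]
  rfl

variable {A B C K K' Q : Type v} [AddCommGroup A] [Module R A] [AddCommGroup B] [Module R B]
  [AddCommGroup C] [Module R C] [AddCommGroup K] [Module R K] [AddCommGroup K'] [Module R K']
  [AddCommGroup Q] [Module R Q]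

namespace ExtOneVanishes

theorem exists_extend (h : ExtOneVanishes R K Q) {i : A →ₗ[R] B} {p : B →ₗ[R] K}
    (hi : Injective i) (hip : Exact i p) (hp : Surjective p) (φ : A →ₗ[R] Q) :
    ∃ ψ : B →ₗ[R] Q, ∀ a, ψ (i a) = φ a := by
  let j : A →ₗ[R] LinearMap.ker p := i.codRestrict _ fun a => hip.apply_apply_eq_zero a
  have hj : Bijective j := by
    refine ⟨fun a b hab => hi (congrArg Subtype.val hab), fun x => ?_⟩
    obtain ⟨a, ha⟩ := (hip x).1 x.2
    exact ⟨a, Subtype.ext ha⟩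
  obtain ⟨ψ, hψ⟩ := h B p hp (φ ∘ₗ (LinearEquiv.ofBijective j hj).symm.toLinearMap)
  refine ⟨ψ, fun a => ?_⟩
  have hja : (LinearEquiv.ofBijective j hj).symm (j a) = a := by
    rw [LinearEquiv.symm_apply_eq]; rfl
  have := hψ (j a)
  rw [LinearMap.comp_apply, LinearEquiv.coe_coe, hja] at this
  exact this

theorem of_retract (h : ExtOneVanishes R K Q) (s : K' →ₗ[R] K) (r : K →ₗ[R] K')
    (hrs : ∀ x, r (s x) = x) : ExtOneVanishes R K' Q := by
  intro B _ _ p hp φ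
  -- The pullback of `p` along `r` is an extension of `K` by `ker p`; the map `b ↦ (b, s (p b))`
  -- embeds `B` in it.
  let D : Submodule R (B × K) := LinearMap.eqLocus (p ∘ₗ LinearMap.fst R B K)
    (r ∘ₗ LinearMap.snd R B K)
  let q : D →ₗ[R] K := LinearMap.snd R B K ∘ₗ D.subtype
  let i : LinearMap.ker p →ₗ[R] D :=
    (LinearMap.inl R B K ∘ₗ (LinearMap.ker p).subtype).codRestrict D fun x => by
      change p x = r 0
      rw [map_zero]; exact x.2
  have hq : Surjective q := fun k => by
    obtain ⟨b, hb⟩ := hp (r k)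
    exact ⟨⟨(b, k), hb⟩, rfl⟩
  have hi : Injective i := fun x y hxy =>
    Subtype.ext (congrArg (fun z : D => z.1.1) hxy)
  have hiq : Exact i q := by
    rintro ⟨⟨b, k⟩, hbk⟩
    constructor
    · rintro (rfl : k = 0)
      have hb : p b = r 0 := hbk
      rw [map_zero] at hb
      exact ⟨⟨b, hb⟩, rfl⟩
    · rintro ⟨x, hx⟩
      exact (congrArg (fun z : D => z.1.2) hx).symm
  obtain ⟨ψ, hψ⟩ := h.exists_extend hi hiq hq φ
  let t : B →ₗ[R] D := (LinearMap.id.prod (s ∘ₗ p)).codRestrict D fun b => (hrs (p b)).symm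
  refine ⟨ψ ∘ₗ t, fun x => ?_⟩
  rw [← hψ x]
  refine congrArg ψ (Subtype.ext (Prod.ext rfl ?_))
  change s (p x) = 0
  rw [LinearMap.mem_ker.1 x.2, map_zero]

theorem of_linearEquiv (h : ExtOneVanishes R K Q) (e : K' ≃ₗ[R] K) : ExtOneVanishes R K' Q :=
  h.of_retract e.toLinearMap e.symm.toLinearMap e.symm_apply_apply

/-- A map extends in two stages: to the preimage `N` of `A`, then from `N` to `E`. -/
theorem middle {i : A →ₗ[R] B} {p : B →ₗ[R] C} (hi : Injective i) (hip : Exact i p)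
    (hp : Surjective p) (hA : ExtOneVanishes R A Q) (hC : ExtOneVanishes R C Q) :
    ExtOneVanishes R B Q := by
  intro E _ _ q hq φ
  let N : Submodule R E := LinearMap.ker (p ∘ₗ q)
  have hN : ∀ x : N, ∃ a, i a = q x := fun x => (hip (q x)).1 x.2
  let e : A ≃ₗ[R] LinearMap.range i := LinearEquiv.ofInjective i hi
  let g : N →ₗ[R] A := e.symm.toLinearMap ∘ₗ
    (q ∘ₗ N.subtype).codRestrict (LinearMap.range i) fun x => hN x
  have hg : ∀ x : N, i (g x) = q x := fun x =>
    congrArg Subtype.val (e.apply_symm_apply ⟨q x, hN x⟩)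
  let j : LinearMap.ker q →ₗ[R] N := Submodule.inclusion fun x hx => by
    change p (q x) = 0
    rw [LinearMap.mem_ker.1 hx, map_zero]
  have hgs : Surjective g := fun a => by
    obtain ⟨x, hx⟩ := hq (i a)
    have hxN : x ∈ N := by
      change p (q x) = 0
      rw [hx, hip.apply_apply_eq_zero]
    exact ⟨⟨x, hxN⟩, hi (by rw [hg, ← hx])⟩
  have hjg : Exact j g := fun x => by
    constructor
    · intro hx
      have : q x = 0 := by rw [← hg, hx, map_zero]
      exact ⟨⟨x, this⟩, rfl⟩
    · rintro ⟨y, rfl⟩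
      exact hi (by rw [hg, map_zero]; exact y.2)
  obtain ⟨ψ, hψ⟩ := hA.exists_extend (Submodule.inclusion_injective _) hjg hgs φ
  obtain ⟨θ, hθ⟩ := hC E (p ∘ₗ q) (hp.comp hq) ψ
  exact ⟨θ, fun x => (hθ (j x)).trans (hψ x)⟩

/-- `Ext¹(K, Q)` may be tested on a single projective presentation of `K`. -/
theorem of_projective [Module.Projective R B] (p : B →ₗ[R] K) (hp : Surjective p)
    (h : ∀ φ : LinearMap.ker p →ₗ[R] Q, ∃ ψ : B →ₗ[R] Q, ∀ x : LinearMap.ker p, ψ x = φ x) :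
    ExtOneVanishes R K Q := by
  intro E _ _ q hq φ
  obtain ⟨l, hl⟩ := Module.projective_lifting_property q p hq
  have hl' : ∀ b, q (l b) = p b := fun b => LinearMap.congr_fun hl b
  let l₀ : LinearMap.ker p →ₗ[R] LinearMap.ker q :=
    (l ∘ₗ (LinearMap.ker p).subtype).codRestrict _ fun x => (hl' x).trans x.2
  obtain ⟨ψ, hψ⟩ := h (φ ∘ₗ l₀)
  -- `E` is the pushout of `ker q` and `B` over `ker p`, so `φ` and `ψ` glue.
  have hs : Surjective ((LinearMap.ker q).subtype.coprod l) := fun x => by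
    obtain ⟨b, hb⟩ := hp (q x)
    have : x - l b ∈ LinearMap.ker q := by
      rw [LinearMap.mem_ker, map_sub, hl', hb, sub_self]
    exact ⟨(⟨x - l b, this⟩, b), by simp⟩
  obtain ⟨χ, hχ⟩ := LinearMap.exists_comp_eq_of_surjective hs (φ.coprod ψ) (by
    rintro ⟨x, b⟩ hxb
    simp only [LinearMap.coprod_apply, Submodule.coe_subtype] at hxb ⊢
    have hb : b ∈ LinearMap.ker p := by
      have := congrArg q hxb
      rwa [map_add, LinearMap.mem_ker.1 x.2, zero_add, hl', map_zero] at this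
    rw [hψ ⟨b, hb⟩, LinearMap.comp_apply, ← map_add,
      show x + l₀ ⟨b, hb⟩ = 0 from Subtype.ext hxb, map_zero])
  refine ⟨χ, fun x => ?_⟩
  simpa using hχ (x, 0)

end ExtOneVanishes

end Extension

/-! ### Modules of finite projective dimension -/

section FiniteProjDim

variable {R : Type u} [Ring R] [Small.{v} R]

theorem HasFiniteProjDim.of_projective (P : Type v) [AddCommGroup P] [Module R P]
    [Module.Projective R P] : HasFiniteProjDim R P := by
  refine (projectiveDimension_ne_top_iff _).2 ⟨0, ?_⟩
  have : Projective (ModuleCat.of R P) := (IsProjective.iff_projective P).1 inferInstance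
  exact (projective_iff_hasProjectiveDimensionLE_zero _).1 this

theorem exists_projective_presentation (Q : Type v) [AddCommGroup Q] [Module R Q] :
    ∃ (F : ModuleCat.{v} R) (π : F →ₗ[R] Q), Module.Projective R F ∧ Surjective π := by
  let F : ModuleCat.{v} R := Projective.over (ModuleCat.of R Q)
  have : Projective F := Projective.projective_over _
  exact ⟨F, (Projective.π (ModuleCat.of R Q)).hom, ModuleCat.projective_of_module_projective F,
    (ModuleCat.epi_iff_surjective _).1 inferInstance⟩

theorem HasFiniteProjDim.ker_of_projective {Q : Type v} [AddCommGroup Q] [Module R Q]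
    {F : Type v} [AddCommGroup F] [Module R F] [Module.Projective R F] (π : F →ₗ[R] Q)
    (hπ : Surjective π) {m : ℕ} (hQ : HasProjectiveDimensionLE (ModuleCat.of R Q) (m + 1)) :
    HasProjectiveDimensionLE (ModuleCat.of R (LinearMap.ker π)) m := by
  have hS := LinearMap.shortExact_shortComplexKer hπ
  have : Projective (ModuleCat.of R F) := (IsProjective.iff_projective F).1 inferInstance
  exact (hS.hasProjectiveDimensionLT_X₃_iff m this).1 hQ

/-- Induction on the projective dimension. -/
theorem HasFiniteProjDim.induction {motive : ∀ (Q : Type v) [AddCommGroup Q] [Module R Q], Prop}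
    (projective : ∀ (Q : Type v) [AddCommGroup Q] [Module R Q], Module.Projective R Q → motive Q)
    (step : ∀ (Q F : Type v) [AddCommGroup Q] [Module R Q] [AddCommGroup F] [Module R F]
      (π : F →ₗ[R] Q), Module.Projective R F → Surjective π →
      motive (LinearMap.ker π) → motive Q)
    (Q : Type v) [AddCommGroup Q] [Module R Q] (hQ : HasFiniteProjDim R Q) : motive Q := by
  obtain ⟨m, hm⟩ := (projectiveDimension_ne_top_iff _).1 hQ
  clear hQ
  induction m generalizing Q with
  | zero =>
    exact projective Q ((IsProjective.iff_projective Q).2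
      ((projective_iff_hasProjectiveDimensionLE_zero _).2 hm))
  | succ m ih =>
    obtain ⟨F, π, hF, hπ⟩ := exists_projective_presentation (R := R) Q
    exact step Q F π hF hπ (ih _ (HasFiniteProjDim.ker_of_projective π hπ hm))

theorem HasFiniteProjDim.exists_presentation {P : Type v} [AddCommGroup P] [Module R P]
    (hP : HasFiniteProjDim R P) :
    ∃ (F : ModuleCat.{v} R) (π : F →ₗ[R] P), Module.Projective R F ∧ Surjective π ∧
      HasFiniteProjDim R (LinearMap.ker π) := by
  obtain ⟨m, hm⟩ := (projectiveDimension_ne_top_iff _).1 hP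
  obtain ⟨F, π, hF, hπ⟩ := exists_projective_presentation (R := R) P
  have : HasProjectiveDimensionLE (ModuleCat.of R P) (m + 1) :=
    hasProjectiveDimensionLT_of_ge _ (m + 1) _ (by lia)
  exact ⟨F, π, hF, hπ, (projectiveDimension_ne_top_iff _).2
    ⟨m, HasFiniteProjDim.ker_of_projective π hπ this⟩⟩

/-- A module of finite projective dimension is projective as soon as it has no extensions by
modules of finite projective dimension. -/
theorem HasFiniteProjDim.projective_of_extOneVanishes {P : Type v} [AddCommGroup P] [Module R P]
    (hP : HasFiniteProjDim R P)
    (h : ∀ (Q : Type v) [AddCommGroup Q] [Module R Q], HasFiniteProjDim R Q →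
      ExtOneVanishes R P Q) : Module.Projective R P := by
  obtain ⟨F, π, hF, hπ, hL⟩ := hP.exists_presentation
  -- Extending the identity of `ker π` to `F` splits `π`.
  obtain ⟨ψ, hψ⟩ := h _ hL F π hπ LinearMap.id
  obtain ⟨s, hs⟩ := LinearMap.exists_comp_eq_of_surjective hπ
    (LinearMap.id - (LinearMap.ker π).subtype ∘ₗ ψ) (fun x hx => by
      have := congrArg Subtype.val (hψ ⟨x, hx⟩)
      simp only [LinearMap.id_apply] at this
      simp [this])
  refine Module.Projective.of_split s π (LinearMap.ext fun y => ?_)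
  obtain ⟨x, rfl⟩ := hπ y
  have hk : π (ψ x : F) = 0 := (ψ x).2
  simp [hs, hk]

/-- `Hom(-, Q)` preserves exactness of a totally acyclic complex when `Q` has finite projective
dimension. -/
theorem HasFiniteProjDim.exists_factor {X : ℤ → ModuleCat.{v} R}
    {d : (i : ℤ) → X (i + 1) →ₗ[R] X i} (hd : ∀ i, Exact (d (i + 1)) (d i))
    (hX : ∀ i, Module.Projective R (X i))
    (hQX : ∀ (Q : Type v) [AddCommGroup Q] [Module R Q], Module.Projective R Q →
      ∀ i, Exact (fun φ : X i →ₗ[R] Q => φ ∘ₗ d i)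
        (fun φ : X (i + 1) →ₗ[R] Q => φ ∘ₗ d (i + 1)))
    (Q : Type v) [AddCommGroup Q] [Module R Q] (hQ : HasFiniteProjDim R Q) :
    ∀ (i : ℤ) (φ : X (i + 1) →ₗ[R] Q), φ ∘ₗ d (i + 1) = 0 →
      ∃ χ : X i →ₗ[R] Q, χ ∘ₗ d i = φ := by
  refine HasFiniteProjDim.induction (motive := fun Q _ _ => ∀ (i : ℤ) (φ : X (i + 1) →ₗ[R] Q),
    φ ∘ₗ d (i + 1) = 0 → ∃ χ : X i →ₗ[R] Q, χ ∘ₗ d i = φ) ?_ ?_ Q hQ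
  · exact fun Q _ _ hQ i φ hφ => (hQX Q hQ i φ).1 hφ
  · intro Q F _ _ _ _ π hF hπ ih i φ hφ
    have := hX (i + 1)
    -- Dimension shift: the lift `ψ` fails to be a cocycle only by a cocycle in `ker π`, which is a
    -- coboundary by induction; the corrected lift is a coboundary in `F`.
    obtain ⟨ψ, hψ⟩ := Module.projective_lifting_property π φ hπ
    let ψ' : X (i + 1 + 1) →ₗ[R] LinearMap.ker π := (ψ ∘ₗ d (i + 1)).codRestrict _ fun x => by
      change (π ∘ₗ ψ) (d (i + 1) x) = 0
      rw [hψ]; exact LinearMap.congr_fun hφ x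
    obtain ⟨χ, hχ⟩ := ih (i + 1) ψ' (LinearMap.ext fun x => Subtype.ext (by
      change ψ (d (i + 1) (d (i + 1 + 1) x)) = 0
      rw [(hd (i + 1)).apply_apply_eq_zero, map_zero]))
    obtain ⟨θ, hθ⟩ := (hQX F hF i (ψ - (LinearMap.ker π).subtype ∘ₗ χ)).1 (LinearMap.ext fun x => by
      have : (χ (d (i + 1) x) : F) = ψ (d (i + 1) x) :=
        congrArg Subtype.val (LinearMap.congr_fun hχ x)
      simp [this])
    refine ⟨π ∘ₗ θ, LinearMap.ext fun x => ?_⟩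
    have h₁ : θ (d i x) = ψ x - χ x := LinearMap.congr_fun hθ x
    have h₂ : π (χ x : F) = 0 := (χ x).2
    have h₃ : π (ψ x) = φ x := LinearMap.congr_fun hψ x
    simp [h₁, h₂, h₃]

theorem IsGorensteinProjective.extOneVanishes {G : Type v} [AddCommGroup G] [Module R G]
    (hG : IsGorensteinProjective R G) {Q : Type v} [AddCommGroup Q] [Module R Q]
    (hQ : HasFiniteProjDim R Q) : ExtOneVanishes R G Q := by
  obtain ⟨X, d, hd, hX, hQX, ⟨e⟩⟩ := hG
  refine ExtOneVanishes.of_linearEquiv ?_ e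
  have := hX (0 + 1)
  refine ExtOneVanishes.of_projective (d 0).rangeRestrict (d 0).surjective_rangeRestrict
    fun φ => ?_
  let c : X (0 + 1 + 1) →ₗ[R] LinearMap.ker (d 0).rangeRestrict :=
    (d (0 + 1)).codRestrict _ fun x => Subtype.ext ((hd 0).apply_apply_eq_zero x)
  obtain ⟨χ, hχ⟩ := HasFiniteProjDim.exists_factor hd hX hQX Q hQ (0 + 1) (φ ∘ₗ c)
    (LinearMap.ext fun x => by
      have : c (d (0 + 1 + 1) x) = 0 := Subtype.ext ((hd (0 + 1)).apply_apply_eq_zero x)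
      rw [LinearMap.comp_apply, LinearMap.comp_apply, this, map_zero, LinearMap.zero_apply])
  refine ⟨χ, fun x => ?_⟩
  obtain ⟨y, hy⟩ := (hd 0 x).1 (congrArg Subtype.val x.2)
  rw [← hy, show x = c y from Subtype.ext hy.symm]
  exact LinearMap.congr_fun hχ y

end FiniteProjDim

/-! ### The case `n = 1` -/

section OneSG

variable {R : Type u} [Ring R]

theorem isNSGProjective_one_of_exact {D P : Type v} [AddCommGroup D] [Module R D] [AddCommGroup P]
    [Module R P] [Module.Projective R P] {i : D →ₗ[R] P} {p : P →ₗ[R] D} (hi : Injective i)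
    (hip : Exact i p) (hp : Surjective p)
    (h : ∀ (Q : Type v) [AddCommGroup Q] [Module R Q], Module.Projective R Q →
      ∀ φ : D →ₗ[R] Q, ∃ ψ : P →ₗ[R] Q, ∀ x, ψ (i x) = φ x) :
    IsNSGProjective R 1 D := by
  -- Indices 0 and 2 are the two ends; those above 2 are junk.
  let X : ℕ → ModuleCat.{v} R := fun k => if k = 1 then ModuleCat.of R P else ModuleCat.of R D
  let S : SelfExactSeq R D 1 :=
    { X := X
      f := fun k => match k with
        | 0 => p
        | 1 => i
        | _ + 2 => (0 : D →ₗ[R] D)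
      rightEnd := LinearEquiv.refl R D
      leftEnd := LinearEquiv.refl R D
      surjective_f := hp
      exact_f := fun k hk => by
        obtain rfl : k = 0 := by lia
        exact hip
      injective_f := hi }
  refine ⟨S, fun k hk => ?_, fun Q _ _ hQ => ⟨?_, fun k hk => ?_, fun φ => ?_⟩⟩
  · obtain rfl : k = 0 := by lia
    exact ‹Module.Projective R P›
  · intro φ ψ hφψ
    exact (LinearMap.cancel_right S.surjective_f).1 hφψ
  · obtain rfl : k = 0 := by lia
    intro φ
    constructor
    · intro hφ
      obtain ⟨χ, hχ⟩ := LinearMap.exists_comp_eq_of_surjective hp (φ : P →ₗ[R] Q) (fun x hx => by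
        obtain ⟨y, rfl⟩ := (hip x).1 hx
        exact LinearMap.congr_fun hφ y)
      exact ⟨χ, LinearMap.ext hχ⟩
    · rintro ⟨χ, rfl⟩
      refine LinearMap.ext fun x => ?_
      change χ (p (i x)) = 0
      rw [hip.apply_apply_eq_zero]
      exact map_zero χ
  · obtain ⟨ψ, hψ⟩ := h Q hQ φ
    exact ⟨ψ, LinearMap.ext hψ⟩

theorem IsNSGProjective.exists_exact {D : Type v} [AddCommGroup D] [Module R D]
    (hD : IsNSGProjective R 1 D) :
    ∃ (P : ModuleCat.{v} R) (i : D →ₗ[R] P) (p : P →ₗ[R] D), Module.Projective R P ∧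
      Injective i ∧ Exact i p ∧ Surjective p ∧
      ∀ (Q : Type v) [AddCommGroup Q] [Module R Q], Module.Projective R Q →
        ∀ φ : D →ₗ[R] Q, ∃ ψ : P →ₗ[R] Q, ψ ∘ₗ i = φ := by
  obtain ⟨S, hS, hQ⟩ := hD
  refine ⟨S.X 1, S.f 1 ∘ₗ S.leftEnd.symm.toLinearMap, S.rightEnd.toLinearMap ∘ₗ S.f 0,
    hS 0 one_pos, S.injective_f.comp S.leftEnd.symm.injective, fun x => ?_,
    S.rightEnd.surjective.comp S.surjective_f, fun Q _ _ hPQ φ => ?_⟩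
  · have := S.exact_f 0 one_pos x
    simp only [LinearMap.comp_apply, LinearEquiv.coe_coe, map_eq_zero_iff _ S.rightEnd.injective]
    rw [this]
    exact (S.leftEnd.symm.surjective.range_comp (S.f 1)).symm ▸ Iff.rfl
  · obtain ⟨ψ, hψ⟩ := (hQ Q hPQ).surjective (φ ∘ₗ S.leftEnd.toLinearMap)
    refine ⟨ψ, LinearMap.ext fun x => ?_⟩
    have := LinearMap.congr_fun hψ (S.leftEnd.symm x)
    simpa using this

/-- The complete resolution is constant, with differential `i ∘ p`. -/
theorem IsNSGProjective.isGorensteinProjective {D : Type v} [AddCommGroup D] [Module R D]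
    (hD : IsNSGProjective R 1 D) : IsGorensteinProjective R D := by
  obtain ⟨P, i, p, hP, hi, hip, hp, hQ⟩ := hD.exists_exact
  have hr : LinearMap.range (i ∘ₗ p) = LinearMap.range i :=
    LinearMap.range_comp_of_range_eq_top _ (LinearMap.range_eq_top.2 hp)
  refine ⟨fun _ => P, fun _ => i ∘ₗ p, fun _ x => ?_, fun _ => hP, fun Q _ _ hPQ _ φ => ?_,
    ⟨(LinearEquiv.ofInjective i hi).trans (LinearEquiv.ofEq _ _ hr.symm)⟩⟩
  · change i (p x) = 0 ↔ x ∈ LinearMap.range (i ∘ₗ p)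
    rw [hr, map_eq_zero_iff _ hi]
    exact hip x
  · constructor
    · intro hφ
      obtain ⟨χ, hχ⟩ := LinearMap.exists_comp_eq_of_surjective hp φ (fun x hx => by
        obtain ⟨y, rfl⟩ := (hip x).1 hx
        obtain ⟨z, rfl⟩ := hp y
        exact LinearMap.congr_fun hφ z)
      obtain ⟨θ, rfl⟩ := hQ Q hPQ χ
      exact ⟨θ, LinearMap.ext hχ⟩
    · rintro ⟨χ, rfl⟩
      refine LinearMap.ext fun x => ?_
      simp [hip.apply_apply_eq_zero]

end OneSG

/-! ### Cutting and summing the sequence -/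

namespace SelfExactSeq

variable {R : Type u} [Ring R] {M : Type v} [AddCommGroup M] [Module R M] {n : ℕ}
  (S : SelfExactSeq R M n)

/-- The image of `f i`. -/
abbrev Im (i : ℕ) : Submodule R (S.X i) := LinearMap.range (S.f i)

/-- The right end is the image of `f 0` and the left end is isomorphic to the image of `f n`. -/
noncomputable def imZeroEquiv : S.Im 0 ≃ₗ[R] S.Im n :=
  (LinearEquiv.ofTop _ (LinearMap.range_eq_top.2 S.surjective_f)).trans <|
    S.rightEnd.trans <| S.leftEnd.symm.trans <| LinearEquiv.ofInjective _ S.injective_f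

theorem exact_subtype_rangeRestrict {i : ℕ} (hi : i < n) :
    Exact (S.Im (i + 1)).subtype (S.f i).rangeRestrict := by
  intro x
  rw [← Subtype.coe_inj]
  refine (S.exact_f i hi x).trans ⟨fun h => ⟨⟨x, h⟩, rfl⟩, ?_⟩
  rintro ⟨y, rfl⟩
  exact y.2

variable {S} {Q : Type v} [AddCommGroup Q] [Module R Q]

theorem HomExact.exists_extend (h : S.HomExact Q) {i : ℕ} (hi : i < n)
    (φ : S.Im (i + 1) →ₗ[R] Q) : ∃ ψ : S.X (i + 1) →ₗ[R] Q, ∀ x : S.Im (i + 1), ψ x = φ x := by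
  have key : ∃ ψ : S.X (i + 1) →ₗ[R] Q,
      ψ ∘ₗ S.f (i + 1) = φ ∘ₗ (S.f (i + 1)).rangeRestrict := by
    -- At the last index `i + 1 = n`, surjectivity at the left end replaces exactness.
    rcases (Nat.succ_le_of_lt hi).lt_or_eq with hlt | rfl
    · refine (h.exact (i + 1) hlt _).1 (LinearMap.ext fun x => ?_)
      have : (S.f (i + 1)).rangeRestrict (S.f (i + 1 + 1) x) = 0 :=
        Subtype.ext ((S.exact_f (i + 1) hlt).apply_apply_eq_zero x)
      simp [this]
    · exact h.surjective _
  obtain ⟨ψ, hψ⟩ := key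
  refine ⟨ψ, ?_⟩
  rintro ⟨_, x, rfl⟩
  exact LinearMap.congr_fun hψ x

theorem HomExact.of_extOneVanishes (h : ∀ i < n, ExtOneVanishes R (S.Im i) Q) : S.HomExact Q := by
  -- For `i = 0` the image is all of `X 0`, so no vanishing is needed.
  have ext : ∀ i ≤ n, ∀ φ : S.Im i →ₗ[R] Q, ∃ ψ : S.X i →ₗ[R] Q, ∀ x : S.Im i, ψ x = φ x := by
    rintro (_ | i) hi φ
    · exact ⟨φ ∘ₗ (LinearEquiv.ofTop _ (LinearMap.range_eq_top.2 S.surjective_f)).symm.toLinearMap,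
        fun x => rfl⟩
    · exact (h i hi).exists_extend (Submodule.subtype_injective _)
        (S.exact_subtype_rangeRestrict hi) (LinearMap.surjective_rangeRestrict _) φ
  refine ⟨fun φ ψ hφψ => (LinearMap.cancel_right S.surjective_f).1 hφψ, fun i hi φ => ?_,
    fun φ => ?_⟩
  · constructor
    · intro hφ
      obtain ⟨χ, hχ⟩ := LinearMap.exists_comp_eq_of_surjective (S.f i).surjective_rangeRestrict φ
        (fun x hx => by
          obtain ⟨y, rfl⟩ := (S.exact_f i hi x).1 (congrArg Subtype.val hx)
          exact LinearMap.congr_fun hφ y)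
      obtain ⟨ψ, hψ⟩ := ext i hi.le χ
      exact ⟨ψ, LinearMap.ext fun x => (hψ ((S.f i).rangeRestrict x)).trans (hχ x)⟩
    · rintro ⟨χ, rfl⟩
      refine LinearMap.ext fun x => ?_
      simp [(S.exact_f i hi).apply_apply_eq_zero]
  · let e := LinearEquiv.ofInjective _ S.injective_f
    obtain ⟨ψ, hψ⟩ := ext n le_rfl (φ ∘ₗ e.symm.toLinearMap)
    refine ⟨ψ, LinearMap.ext fun x => (hψ (e x)).trans ?_⟩
    simp

variable (S)

/-- The sum of the images of `f 0, …, f (n - 1)` is isomorphic to that of `f 1, …, f n`. -/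
theorem nonempty_sumIm_rotate :
    Nonempty ((⨁ i : Fin n, S.Im i) ≃ₗ[R] S.SumIm) := by
  rcases n with _ | m
  · exact ⟨(LinearEquiv.ofSubsingleton _ _)⟩
  have key : ∀ k : Fin (m + 1),
      Nonempty (S.Im (finRotate (m + 1) k : Fin (m + 1)) ≃ₗ[R] S.Im ((k : ℕ) + 1)) := by
    intro k
    induction k using Fin.lastCases with
    | last =>
      rw [finRotate_last]
      exact ⟨S.imZeroEquiv⟩
    | cast k =>
      rw [show k.castSucc = ⟨(k : ℕ), k.isLt.trans (Nat.lt_succ_self m)⟩ from rfl,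
        finRotate_of_lt k.isLt]
      exact ⟨LinearEquiv.refl _ _⟩
  exact ⟨(DirectSum.lequivCongrLeft R (finRotate (m + 1)).symm).trans
    (DFinsupp.mapRange.linearEquiv fun k => (key k).some)⟩

theorem isNSGProjective_one_sumIm (hP : ∀ i < n, Module.Projective R (S.P i))
    (hQ : ∀ (Q : Type v) [AddCommGroup Q] [Module R Q], Module.Projective R Q → S.HomExact Q) :
    IsNSGProjective R 1 S.SumIm := by
  obtain ⟨e⟩ := S.nonempty_sumIm_rotate
  have : ∀ i : Fin n, Module.Projective R (S.X ((i : ℕ) + 1)) := fun i => hP i i.isLt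
  let ι : S.SumIm →ₗ[R] ⨁ i : Fin n, S.X ((i : ℕ) + 1) :=
    DirectSum.lmap fun i => (S.Im ((i : ℕ) + 1)).subtype
  let π : (⨁ i : Fin n, S.X ((i : ℕ) + 1)) →ₗ[R] ⨁ i : Fin n, S.Im i :=
    DirectSum.lmap fun i => (S.f i).rangeRestrict
  have hι : Injective ι := (DirectSum.lmap_injective _).2 fun i => Submodule.subtype_injective _
  have hπ : Surjective π := (DirectSum.lmap_surjective _).2 fun i =>
    LinearMap.surjective_rangeRestrict _
  have hιπ : Exact ι π := by
    intro x
    constructor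
    · intro hx
      have hx' : ∀ i : Fin n, x i ∈ S.Im ((i : ℕ) + 1) := fun i => by
        refine (S.exact_f i i.isLt _).1 ?_
        exact congrArg (fun y : ⨁ i : Fin n, S.Im i => (y i : S.X i)) hx
      refine ⟨(DirectSum.linearEquivFunOnFintype R (Fin n) _).symm fun i => ⟨x i, hx' i⟩, ?_⟩
      refine DFinsupp.ext fun i => ?_
      rw [DirectSum.lmap_apply]
      exact congrArg Subtype.val (congrFun ((DirectSum.linearEquivFunOnFintype R (Fin n)
        fun i => S.Im ((i : ℕ) + 1)).apply_symm_apply fun i => ⟨x i, hx' i⟩) i)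
    · rintro ⟨y, rfl⟩
      refine DFinsupp.ext fun i => ?_
      exact (S.exact_subtype_rangeRestrict i.isLt).apply_apply_eq_zero (y i)
  refine isNSGProjective_one_of_exact (p := e.toLinearMap ∘ₗ π) hι (fun x => ?_)
    (e.surjective.comp hπ) fun Q _ _ hPQ φ => ?_
  · simpa using hιπ x
  · choose ψ hψ using fun i : Fin n => (hQ Q hPQ).exists_extend i.isLt
      (φ ∘ₗ DirectSum.lof R (Fin n) (fun i => S.Im ((i : ℕ) + 1)) i)
    refine ⟨DirectSum.toModule R (Fin n) Q ψ, fun x => ?_⟩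
    refine LinearMap.congr_fun (?_ : DirectSum.toModule R (Fin n) Q ψ ∘ₗ ι = φ) x
    refine DirectSum.linearMap_ext R fun i => LinearMap.ext fun y => ?_
    simp only [ι, LinearMap.comp_apply, DirectSum.lmap_lof, DirectSum.toModule_lof]
    exact hψ i y

variable {S}

/-- For `i ≥ 1` the image is a summand. `Im f_0` is not in the sum but is isomorphic to `Im f_n`,
which is there because `n ≥ 1`. -/
theorem extOneVanishes_im (h : ExtOneVanishes R S.SumIm Q) (hn : 1 ≤ n) {i : ℕ} (hi : i ≤ n) :
    ExtOneVanishes R (S.Im i) Q := by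
  have key : ∀ j < n, ExtOneVanishes R (S.Im (j + 1)) Q := fun j hj =>
    h.of_retract (DirectSum.lof R (Fin n) (fun i => S.Im ((i : ℕ) + 1)) ⟨j, hj⟩)
      (DirectSum.component R (Fin n) (fun i => S.Im ((i : ℕ) + 1)) ⟨j, hj⟩)
      (fun x => DirectSum.component.lof_self R (M := fun i : Fin n => S.Im ((i : ℕ) + 1)) ⟨j, hj⟩ x)
  rcases i with _ | i
  · obtain ⟨m, rfl⟩ : ∃ m, n = m + 1 := ⟨n - 1, by lia⟩
    exact (key m (by lia)).of_linearEquiv S.imZeroEquiv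
  · exact key i hi

theorem projective_and_homExact_of_isGorensteinProjective [Small.{v} R] (hn : 1 ≤ n)
    (hP : ∀ i < n, HasFiniteProjDim R (S.P i)) (hG : IsGorensteinProjective R S.SumIm) :
    (∀ i < n, Module.Projective R (S.P i)) ∧
      ∀ (Q : Type v) [AddCommGroup Q] [Module R Q], Module.Projective R Q → S.HomExact Q := by
  refine ⟨fun i hi => (hP i hi).projective_of_extOneVanishes fun Q _ _ hQ => ?_,
    fun Q _ _ hQ => HomExact.of_extOneVanishes fun i hi => ?_⟩
  · have h := hG.extOneVanishes hQ
    exact ExtOneVanishes.middle (Submodule.subtype_injective _)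
      (S.exact_subtype_rangeRestrict hi) (LinearMap.surjective_rangeRestrict _)
      (extOneVanishes_im h hn hi) (extOneVanishes_im h hn hi.le)
  · exact extOneVanishes_im (hG.extOneVanishes (HasFiniteProjDim.of_projective Q)) hn hi.le

end SelfExactSeq

theorem theorem3p9 {R : Type u} [Ring R] [Small.{v} R] (M : Type v) [AddCommGroup M] [Module R M]
    (n : ℕ) (hn : 1 ≤ n) :
    List.TFAE [
      IsNSGProjective R n M,
      ∃ S : SelfExactSeq R M n,
        (∀ i < n, Module.Projective R (S.P i)) ∧ IsNSGProjective R 1 S.SumIm,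
      ∃ S : SelfExactSeq R M n,
        (∀ i < n, Module.Projective R (S.P i)) ∧ IsGorensteinProjective R S.SumIm,
      ∃ S : SelfExactSeq R M n,
        (∀ i < n, HasFiniteProjDim R (S.P i)) ∧ IsNSGProjective R 1 S.SumIm,
      ∃ S : SelfExactSeq R M n,
        (∀ i < n, HasFiniteProjDim R (S.P i)) ∧ IsGorensteinProjective R S.SumIm] := by
  tfae_have 1 → 2
  | ⟨S, hP, hQ⟩ => ⟨S, hP, S.isNSGProjective_one_sumIm hP hQ⟩
  tfae_have 2 → 3
  | ⟨S, hP, hS⟩ => ⟨S, hP, hS.isGorensteinProjective⟩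
  tfae_have 2 → 4
  | ⟨S, hP, hS⟩ => ⟨S, fun i hi => have := hP i hi; HasFiniteProjDim.of_projective _, hS⟩
  tfae_have 3 → 5
  | ⟨S, hP, hS⟩ => ⟨S, fun i hi => have := hP i hi; HasFiniteProjDim.of_projective _, hS⟩
  tfae_have 4 → 5
  | ⟨S, hP, hS⟩ => ⟨S, hP, hS.isGorensteinProjective⟩
  tfae_have 5 → 1
  | ⟨S, hP, hS⟩ => ⟨S, SelfExactSeq.projective_and_homExact_of_isGorensteinProjective hn hP hS⟩
  tfae_finish
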